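/- All vector spaces and algebras are over $\mathbb{C}$. A differential graded algebra (DGA) is a pair $R=(R_\#,D)$, where $R_\#=\bigoplus_{n\ge 0}R^n$ is a graded supercommutative associative unital algebra (the parity of $R^n$ being that of $n$) and $D$ is a (super)derivation of degree $-1$ with $D^2=0$. It is quasi-free if $R_\#$ is the (super)symmetric algebra $S^\bullet V$ of a graded superspace $V=\bigoplus_{n\ge0}V^n$, $V^n\subset R^n$, with every $V^n$ finite-dimensional. For $n\in\mathbb{Z}$ let $\mathrm{Der}(R)^n$ be the space of superderivations $\tau$ of $R$ of degree $n$, i.e. $\tau(R^m)\subset R^{m+n}$ for all $m$ (with $R^k=0$ for $k<0$) and $\tau(ab)=\tau(a)b+(-1)^{nm}a\tau(b)$ for $a\in R^m$, $b\in R$. The supercommutator makes $\mathrm{Der}(R)=\bigoplus_n\mathrm{Der}(R)^n$ a graded Lie superalgebra, $[D,\cdot]:\mathrm{Der}(R)^n\to\mathrm{Der}(R)^{n-1}$ is a square-zero derivation of it, and the homology $H^\bullet_{[D,\cdot]}(\mathrm{Der}(R))$ inherits a grading and a Lie bracket. Lemma 4.5.1. Let $A$ be a finitely generated commutative associative unital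 algebra, and let $\pi:R\to A$ be a quasi-free DGA resolution, i.e. $R$ is a quasi-free DGA and $\pi$ is a quasi-isomorphism of DGAs, where $A$ is placed in degree $0$ with zero differential. Put $\mathrm{Der}(A)^n=H^n_{[D,\cdot]}(\mathrm{Der}(R))$. Then (a) $\mathrm{Der}(A)^n=0$ for all $n>0$; (b) $\mathrm{Der}(A)^0$ is the Lie algebra of derivations of $A$: there is an isomorphism of Lie algebras $\Phi$ from $\mathrm{Der}(A)^0$ onto the Lie algebra $\mathrm{Der}_{\mathbb{C}}(A)$ of $\mathbb{C}$-linear derivations of $A$ such that $\Phi([\tau])(\pi(r))=\pi(\tau(r))$ for every $\tau\in\mathrm{Der}(R)^0$ with $[D,\tau]=0$ and every $r\in R$. -/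

import Mathlib

universe u v

set_option maxSynthPendingDepth 3

/-- The relations `v w = (-1)^(i j) w v`, for `v` of degree `i` and `w` of degree `j`, which cut the
supersymmetric algebra of a graded vector space out of its tensor algebra. -/
inductive SuperSymRel (V : ℕ → Type v) [∀ n, AddCommGroup (V n)] [∀ n, Module ℂ (V n)] :
    TensorAlgebra ℂ (DirectSum ℕ V) → TensorAlgebra ℂ (DirectSum ℕ V) → Prop
  | swap (i j : ℕ) (v : V i) (w : V j) :
      SuperSymRel V
        (TensorAlgebra.ι ℂ (DirectSum.lof ℂ ℕ V i v) * TensorAlgebra.ι ℂ (DirectSum.lof ℂ ℕ V j w))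
        ((-1 : ℂ) ^ (i * j) •
          (TensorAlgebra.ι ℂ (DirectSum.lof ℂ ℕ V j w) *
            TensorAlgebra.ι ℂ (DirectSum.lof ℂ ℕ V i v)))

/-- The symmetric algebra (in the super sense) of the graded vector superspace
`V = ⨁ V n`, the parity of `V n` being the parity of `n`. -/
abbrev SuperSym (V : ℕ → Type v) [∀ n, AddCommGroup (V n)] [∀ n, Module ℂ (V n)] : Type v :=
  RingQuot (SuperSymRel V)

/-- The canonical map from the degree `n` component of `V` to the symmetric algebra of `V`. -/
noncomputable def SuperSym.ι (V : ℕ → Type v) [∀ n, AddCommGroup (V n)] [∀ n, Module ℂ (V n)]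
    (n : ℕ) : V n →ₗ[ℂ] SuperSym V :=
  (RingQuot.mkAlgHom ℂ (SuperSymRel V)).toLinearMap ∘ₗ
    TensorAlgebra.ι ℂ ∘ₗ DirectSum.lof ℂ ℕ V n

/-- The components of an `ℕ`-grading, indexed by `ℤ`, with zero in negative degrees. -/
def intPiece {R : Type u} [AddCommGroup R] [Module ℂ R] (P : ℕ → Submodule ℂ R) :
    ℤ → Submodule ℂ R
  | Int.ofNat m => P m
  | Int.negSucc _ => ⊥

/-- The space of (super)derivations of degree `n` of an algebra graded by `P`. -/
def gradedDer {R : Type u} [Ring R] [Algebra ℂ R] (P : ℕ → Submodule ℂ R) (n : ℤ) :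
    Submodule ℂ (Module.End ℂ R) where
  carrier := {f | (∀ (i : ℕ), ∀ a ∈ P i, f a ∈ intPiece P (i + n)) ∧
    ∀ (i : ℕ), ∀ a ∈ P i, ∀ b : R, f (a * b) = f a * b + (-1 : ℂ) ^ (n * i) • (a * f b)}
  zero_mem' := by simp
  add_mem' := by
    rintro f g ⟨hf, hf'⟩ ⟨hg, hg'⟩
    refine ⟨fun i a ha => add_mem (hf i a ha) (hg i a ha), fun i a ha b => ?_⟩
    simp only [LinearMap.add_apply, hf' i a ha b, hg' i a ha b, add_mul, mul_add, smul_add]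
    abel
  smul_mem' := by
    rintro c f ⟨hf, hf'⟩
    refine ⟨fun i a ha => Submodule.smul_mem _ _ (hf i a ha), fun i a ha b => ?_⟩
    simp only [LinearMap.smul_apply, hf' i a ha b, smul_add, smul_mul_assoc, mul_smul_comm]
    rw [smul_comm c]

/-- The supercommutator `f g - (-1)^(p q) g f` of operators `f`, `g` of degrees `p`, `q`. -/
noncomputable def superBracket {R : Type u} [AddCommGroup R] [Module ℂ R] (p q : ℤ) :
    Module.End ℂ R →ₗ[ℂ] Module.End ℂ R →ₗ[ℂ] Module.End ℂ R :=
  LinearMap.mul ℂ (Module.End ℂ R) - (-1 : ℂ) ^ (p * q) • (LinearMap.mul ℂ (Module.End ℂ R)).flip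

section BracketLemmas

variable {R : Type u} [Ring R] [Algebra ℂ R] {P : ℕ → Submodule ℂ R}

theorem superBracket_eq (p q : ℤ) (f g : Module.End ℂ R) :
    superBracket p q f g = f * g - (-1 : ℂ) ^ (p * q) • (g * f) := rfl

theorem negOne_zpow_mul_self (n : ℤ) : (-1 : ℂ) ^ n * (-1 : ℂ) ^ n = 1 := by
  rw [← mul_zpow]; simp

theorem gradedDer_map {n : ℤ} {f : Module.End ℂ R} (hf : f ∈ gradedDer P n) (k : ℤ) {a : R}
    (ha : a ∈ intPiece P k) : f a ∈ intPiece P (k + n) := by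
  cases k with
  | ofNat m => exact hf.1 m a ha
  | negSucc m =>
    have : a = 0 := ha
    simp [this]

theorem gradedDer_leibniz {n : ℤ} {f : Module.End ℂ R} (hf : f ∈ gradedDer P n) (k : ℤ) {a : R}
    (ha : a ∈ intPiece P k) (b : R) :
    f (a * b) = f a * b + (-1 : ℂ) ^ (n * k) • (a * f b) := by
  cases k with
  | ofNat m => exact hf.2 m a ha b
  | negSucc m =>
    have : a = 0 := ha
    simp [this]

theorem superBracket_mem {p q r : ℤ} (h : p + q = r) {f g : Module.End ℂ R}
    (hf : f ∈ gradedDer P p) (hg : g ∈ gradedDer P q) :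
    superBracket p q f g ∈ gradedDer P r := by
  subst h
  refine ⟨fun i a ha => ?_, fun i a ha b => ?_⟩
  · have ha' : a ∈ intPiece P (i : ℤ) := ha
    have h1 := gradedDer_map hf _ (gradedDer_map hg _ ha')
    have h2 := gradedDer_map hg _ (gradedDer_map hf _ ha')
    rw [show (i : ℤ) + q + p = i + (p + q) by ring] at h1
    rw [show (i : ℤ) + p + q = i + (p + q) by ring] at h2
    exact sub_mem h1 (Submodule.smul_mem _ _ h2)
  · have ha' : a ∈ intPiece P (i : ℤ) := ha
    have hga := gradedDer_map hg _ ha'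
    have hfa := gradedDer_map hf _ ha'
    simp only [superBracket_eq, LinearMap.sub_apply, Module.End.mul_apply, LinearMap.smul_apply,
      gradedDer_leibniz hg _ ha', gradedDer_leibniz hf _ ha', map_add, map_smul,
      gradedDer_leibniz hf _ hga, gradedDer_leibniz hg _ hfa, smul_add, smul_smul, sub_mul,
      mul_sub, smul_sub, smul_mul_assoc, mul_smul_comm, mul_add, add_mul]
    have hne : (-1 : ℂ) ≠ 0 := by norm_num
    simp only [zpow_add₀ hne, mul_comm q p]
    have hpq := negOne_zpow_mul_self (p * q)
    generalize (-1 : ℂ) ^ (p * q) = s at *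
    generalize (-1 : ℂ) ^ (p * (i : ℤ)) = x at *
    generalize (-1 : ℂ) ^ (q * (i : ℤ)) = y at *
    match_scalars
    · ring
    · ring
    · linear_combination (-y) * hpq
    · ring
    · ring
    · ring

end BracketLemmas

/-- A differential graded algebra with underlying algebra `R`: a supercommutative grading
`R = ⨁_{n ≥ 0} piece n` together with a derivation `D` of degree `-1` and square zero. -/
structure DGAlg (R : Type u) [Ring R] [Algebra ℂ R] where
  /-- the homogeneous components -/
  piece : ℕ → Submodule ℂ R
  /-- the components form an algebra grading -/
  graded : GradedAlgebra piece
  /-- supercommutativity -/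
  supercomm : ∀ (i j : ℕ), ∀ a ∈ piece i, ∀ b ∈ piece j, a * b = (-1 : ℂ) ^ (i * j) • (b * a)
  /-- the differential -/
  D : Module.End ℂ R
  /-- the differential is a derivation of degree `-1` -/
  D_mem : D ∈ gradedDer piece (-1)
  /-- the differential squares to zero -/
  D_sq : D * D = 0

namespace DGAlg

section

variable {R : Type u} [Ring R] [Algebra ℂ R] (S : DGAlg R)

/-- The homology `Ker D / Im D` of a differential graded algebra. -/
abbrev Homology : Type u :=
  LinearMap.ker S.D ⧸ (LinearMap.range S.D).submoduleOf (LinearMap.ker S.D)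

/-- `R` is the symmetric algebra of a graded space `V = ⨁_{n ≥ 0} V n` of generators, with each
`V n` finite-dimensional and sitting in degree `n` of `R`. -/
def IsQuasiFree : Prop :=
  ∃ V : ℕ → Submodule ℂ R,
    (∀ n, V n ≤ S.piece n) ∧ (∀ n, FiniteDimensional ℂ (V n)) ∧
    ∃ e : SuperSym (fun n => V n) ≃ₐ[ℂ] R,
      ∀ (n : ℕ) (x : V n), e (SuperSym.ι (fun n => V n) n x) = x

variable {A : Type v} [CommRing A] [Algebra ℂ A]

/-- `π` is a morphism of differential graded algebras to `A`, where `A` is placed in degree `0` and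
has zero differential. -/
structure IsAugmentation (π : R →ₐ[ℂ] A) : Prop where
  map_pos : ∀ n : ℕ, 0 < n → ∀ a ∈ S.piece n, π a = 0
  map_D : ∀ a : R, π (S.D a) = 0

variable {S} in
/-- The map induced on homology by a morphism to `A`. -/
def IsAugmentation.homologyMap {π : R →ₐ[ℂ] A} (h : S.IsAugmentation π) : S.Homology →ₗ[ℂ] A :=
  Submodule.liftQ _ (π.toLinearMap ∘ₗ (LinearMap.ker S.D).subtype) (by
    rintro ⟨x, hx⟩ ⟨y, hy⟩
    have hy' : S.D y = x := hy
    change π x = 0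
    rw [← hy', h.map_D])

/-- `π` is a quasi-isomorphism of differential graded algebras from `R` to `A`. -/
def IsResolution (π : R →ₐ[ℂ] A) : Prop :=
  ∃ h : S.IsAugmentation π, Function.Bijective h.homologyMap

/-- The derivations of `R` of degree `n`. -/
abbrev Der (n : ℤ) : Submodule ℂ (Module.End ℂ R) := gradedDer S.piece n

/-- The differential `[D, ·]` on operators of degree `n`. -/
noncomputable def adD (n : ℤ) : Module.End ℂ R →ₗ[ℂ] Module.End ℂ R := superBracket (-1) n S.D

theorem adD_mem {n m : ℤ} (h : m + 1 = n) {f : Module.End ℂ R} (hf : f ∈ S.Der n) :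
    S.adD n f ∈ S.Der m :=
  superBracket_mem (by omega) S.D_mem hf

theorem negOne_zpow_neg_one_mul (n : ℤ) : (-1 : ℂ) ^ (-1 * n) = (-1 : ℂ) ^ n := by
  rw [neg_one_mul, zpow_neg, ← inv_zpow]; norm_num

theorem adD_apply (n : ℤ) (f : Module.End ℂ R) :
    S.adD n f = S.D * f - (-1 : ℂ) ^ n • (f * S.D) := by
  rw [adD, superBracket_eq, negOne_zpow_neg_one_mul]

theorem adD_adD {n m : ℤ} (h : m + 1 = n) (f : Module.End ℂ R) : S.adD m (S.adD n f) = 0 := by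
  subst h
  have hne : (-1 : ℂ) ≠ 0 := by norm_num
  simp only [adD_apply, mul_sub, sub_mul, mul_smul_comm, smul_mul_assoc, smul_sub, mul_assoc,
    S.D_sq, mul_zero, smul_zero, zpow_add₀ hne, zpow_one]
  rw [← mul_assoc, S.D_sq]
  simp only [zero_mul, mul_neg, mul_one]
  module

/-- The bracket is a morphism of complexes. -/
theorem adD_superBracket {p q r : ℤ} (h : p + q = r) (f g : Module.End ℂ R) :
    S.adD r (superBracket p q f g) =
      superBracket (p - 1) q (S.adD p f) g +
        (-1 : ℂ) ^ p • superBracket p (q - 1) f (S.adD q g) := by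
  subst h
  have hne : (-1 : ℂ) ≠ 0 := by norm_num
  have hp := negOne_zpow_mul_self p
  have hq := negOne_zpow_mul_self q
  simp only [adD_apply, superBracket_eq, mul_sub, sub_mul, mul_smul_comm, smul_mul_assoc, smul_sub,
    mul_assoc, smul_smul, zpow_add₀ hne, zpow_sub₀ hne, mul_one, one_mul, div_eq_mul_inv]
  rw [inv_eq_of_mul_eq_one_left hp, inv_eq_of_mul_eq_one_left hq]
  generalize (-1 : ℂ) ^ (p * q) = s at *
  generalize (-1 : ℂ) ^ p = x at *
  generalize (-1 : ℂ) ^ q = y at *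
  match_scalars
  all_goals first
    | ring1
    | linear_combination s * hp
    | linear_combination (-s) * hp
    | linear_combination (s * y) * hp
    | linear_combination (-s * y) * hp

/-- Cycles of degree `n` in the complex of derivations with differential `[D, ·]`. -/
noncomputable def derCycles (n : ℤ) : Submodule ℂ (Module.End ℂ R) :=
  S.Der n ⊓ LinearMap.ker (S.adD n)

/-- Boundaries of degree `n` in the complex of derivations with differential `[D, ·]`. -/
noncomputable def derBoundaries (n : ℤ) : Submodule ℂ (Module.End ℂ R) :=
  (S.Der (n + 1)).map (S.adD (n + 1))

/-- The homology of degree `n` of the complex of derivations with differential `[D, ·]`. -/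
abbrev DerHomology (n : ℤ) : Type u :=
  S.derCycles n ⧸ (S.derBoundaries n).submoduleOf (S.derCycles n)

theorem derBoundaries_le_derCycles (n : ℤ) : S.derBoundaries n ≤ S.derCycles n := by
  rintro _ ⟨f, hf, rfl⟩
  exact ⟨S.adD_mem rfl hf, S.adD_adD rfl f⟩

theorem superBracket_mem_derCycles {p q r : ℤ} (h : p + q = r) {f g : Module.End ℂ R}
    (hf : f ∈ S.derCycles p) (hg : g ∈ S.derCycles q) :
    superBracket p q f g ∈ S.derCycles r := by
  refine ⟨superBracket_mem h hf.1 hg.1, ?_⟩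
  have hf' : S.adD p f = 0 := hf.2
  have hg' : S.adD q g = 0 := hg.2
  change S.adD r _ = 0
  rw [S.adD_superBracket h, hf', hg']
  simp

theorem superBracket_mem_derBoundaries_left {p q r : ℤ} (h : p + q = r) {f g : Module.End ℂ R}
    (hf : f ∈ S.derBoundaries p) (hg : g ∈ S.derCycles q) :
    superBracket p q f g ∈ S.derBoundaries r := by
  obtain ⟨f, hf, rfl⟩ := hf
  have hg' : S.adD q g = 0 := hg.2
  refine ⟨superBracket (p + 1) q f g, superBracket_mem (by omega) hf hg.1, ?_⟩
  rw [S.adD_superBracket (by omega), hg', add_sub_cancel_right]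
  simp

theorem superBracket_mem_derBoundaries_right {p q r : ℤ} (h : p + q = r) {f g : Module.End ℂ R}
    (hf : f ∈ S.derCycles p) (hg : g ∈ S.derBoundaries q) :
    superBracket p q f g ∈ S.derBoundaries r := by
  obtain ⟨g, hg, rfl⟩ := hg
  have hf' : S.adD p f = 0 := hf.2
  refine ⟨(-1 : ℂ) ^ p • superBracket p (q + 1) f g,
    Submodule.smul_mem _ _ (superBracket_mem (by omega) hf.1 hg), ?_⟩
  rw [map_smul, S.adD_superBracket (by omega), hf', add_sub_cancel_right, map_zero,
    LinearMap.zero_apply, zero_add, smul_smul, negOne_zpow_mul_self, one_smul]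

/-- The graded Lie bracket on cycles. -/
noncomputable def cycleBracket {p q r : ℤ} (h : p + q = r) :
    S.derCycles p →ₗ[ℂ] S.derCycles q →ₗ[ℂ] S.derCycles r :=
  LinearMap.mk₂ ℂ
    (fun f g => ⟨superBracket p q f.1 g.1, S.superBracket_mem_derCycles h f.2 g.2⟩)
    (fun f f' g => Subtype.ext (by simp))
    (fun c f g => Subtype.ext (by simp))
    (fun f g g' => Subtype.ext (by simp))
    (fun c f g => Subtype.ext (by simp))

/-- The graded Lie bracket on the homology of the complex of derivations. -/
noncomputable def homologyBracket {p q r : ℤ} (h : p + q = r) :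
    S.DerHomology p →ₗ[ℂ] S.DerHomology q →ₗ[ℂ] S.DerHomology r :=
  Submodule.liftQ _
    { toFun := fun f => Submodule.liftQ _
        (Submodule.mkQ ((S.derBoundaries r).submoduleOf (S.derCycles r)) ∘ₗ S.cycleBracket h f)
        (fun g hg => (Submodule.Quotient.mk_eq_zero _).2
          (S.superBracket_mem_derBoundaries_right h f.2 hg))
      map_add' := fun f f' => by
        refine Submodule.linearMap_qext _ (LinearMap.ext fun g => ?_)
        exact congrArg (Submodule.Quotient.mk (p := (S.derBoundaries r).submoduleOf (S.derCycles r)))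
          (LinearMap.map_add₂ (S.cycleBracket h) f f' g)
      map_smul' := fun c f => by
        refine Submodule.linearMap_qext _ (LinearMap.ext fun g => ?_)
        exact congrArg (Submodule.Quotient.mk (p := (S.derBoundaries r).submoduleOf (S.derCycles r)))
          (LinearMap.map_smul₂ (S.cycleBracket h) c f g) }
    (fun f hf => by
      refine Submodule.linearMap_qext _ (LinearMap.ext fun g => ?_)
      exact (Submodule.Quotient.mk_eq_zero _).2
        (S.superBracket_mem_derBoundaries_left h hf g.2))

theorem homologyBracket_mk {p q r : ℤ} (h : p + q = r) (f : S.derCycles p) (g : S.derCycles q) :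
    S.homologyBracket h (Submodule.Quotient.mk f) (Submodule.Quotient.mk g) =
      Submodule.Quotient.mk (S.cycleBracket h f g) := rfl

theorem cycleBracket_zero_coe (f g : S.derCycles 0) :
    (S.cycleBracket (add_zero 0) f g : Module.End ℂ R) = f.1 * g.1 - g.1 * f.1 := by
  change superBracket 0 0 f.1 g.1 = _
  simp [superBracket_eq]

/-- The degree `0` part of the homology is a Lie algebra under the graded Lie bracket. -/
noncomputable instance derHomologyLieRing : LieRing (S.DerHomology 0) where
  bracket x y := S.homologyBracket (add_zero 0) x y
  add_lie x y z := LinearMap.map_add₂ (S.homologyBracket (add_zero 0)) x y z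
  lie_add x y z := (S.homologyBracket (add_zero 0) x).map_add y z
  lie_self x := by
    induction x using Submodule.Quotient.induction_on with | _ f
    change S.homologyBracket _ _ _ = 0
    rw [homologyBracket_mk]
    have h0 : S.cycleBracket (add_zero 0) f f = 0 :=
      Subtype.ext ((S.cycleBracket_zero_coe f f).trans (sub_self (f.1 * f.1)))
    rw [h0, Submodule.Quotient.mk_zero]
  leibniz_lie x y z := by
    induction x using Submodule.Quotient.induction_on with | _ f
    induction y using Submodule.Quotient.induction_on with | _ g
    induction z using Submodule.Quotient.induction_on with | _ k
    change S.homologyBracket _ _ (S.homologyBracket _ _ _) =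
      S.homologyBracket _ (S.homologyBracket _ _ _) _ +
        S.homologyBracket _ _ (S.homologyBracket _ _ _)
    rw [homologyBracket_mk, homologyBracket_mk, homologyBracket_mk, homologyBracket_mk,
      homologyBracket_mk, homologyBracket_mk, ← Submodule.Quotient.mk_add]
    refine congrArg _ (Subtype.ext ?_)
    rw [Submodule.coe_add]
    simp only [cycleBracket_zero_coe]
    noncomm_ring

noncomputable instance derHomologyLieAlgebra : LieAlgebra ℂ (S.DerHomology 0) where
  lie_smul c x y := (S.homologyBracket (add_zero 0) x).map_smul c y

end

end DGAlg

/-! Everything rests on one acyclicity statement, `exists_adD_eq`. Since `π` is a quasi-isomorphism,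
`ker π` is an acyclic subcomplex of `R`. A derivation of a free algebra is given by arbitrary values
on generators (`IsFreeOn.exists_der`), so the derivations of `R` with values in `ker π` again form
an acyclic complex: a primitive of a cycle is built by induction on the degree of generators, the
obstruction at each stage being a cycle in `ker π`.

A derivation of positive degree has values in positive degrees, hence in `ker π`; this gives the
vanishing for `n > 0`. A cycle of degree `0` commutes with `D`, preserves `ker π` and so descends to
a derivation of `A`. It descends to zero exactly when its values lie in `ker π`, and by acyclicity
this means that it is a boundary. Conversely, a derivation of `A` lifts through generators to a
derivation `τ` of `R`; `[D, τ]` has values in `ker π`, and acyclicity corrects `τ` to a cycle. -/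

theorem exists_linearMap_lift {V W U : Type*} [AddCommGroup V] [Module ℂ V] [AddCommGroup W]
    [Module ℂ W] [AddCommGroup U] [Module ℂ U] (D : W →ₗ[ℂ] U) (B : Submodule ℂ W)
    (g : V →ₗ[ℂ] U) (h : ∀ v, ∃ b ∈ B, D b = g v) :
    ∃ s : V →ₗ[ℂ] W, ∀ v, s v ∈ B ∧ D (s v) = g v := by
  choose c hc hD using h
  -- The pointwise choice `c` need not be linear, so only its values on a basis are kept.
  let b := Module.Basis.ofVectorSpace ℂ V
  let s := b.constr ℂ (fun i => c (b i))
  have hs : ∀ i, s (b i) = c (b i) := fun i => b.constr_basis ℂ _ i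
  refine ⟨s, fun v => ⟨?_, ?_⟩⟩
  · have : ⊤ ≤ B.comap s := by
      rw [← b.span_eq, Submodule.span_le]
      rintro _ ⟨i, rfl⟩
      change s (b i) ∈ B
      rw [hs]; exact hc _
    exact this trivial
  · have : D ∘ₗ s = g := b.ext fun i => by rw [LinearMap.comp_apply, hs, hD]
    exact LinearMap.congr_fun this v

theorem mul_comm_of_mem_intPiece {R : Type u} [Ring R] [Algebra ℂ R] (S : DGAlg R) (j : ℕ) (k : ℤ)
    {a b : R} (ha : a ∈ intPiece S.piece k) (hb : b ∈ S.piece j) :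
    a * b = (-1 : ℂ) ^ (k * j) • (b * a) := by
  cases k with
  | ofNat m =>
    have := S.supercomm m j a ha b hb
    rwa [show (-1 : ℂ) ^ (Int.ofNat m * (j : ℤ)) = (-1 : ℂ) ^ (m * j) from
      zpow_natCast (-1 : ℂ) (m * j)]
  | negSucc m =>
    have : a = 0 := ha
    simp [this]

theorem mul_mem_intPiece {R : Type u} [Ring R] [Algebra ℂ R] (S : DGAlg R) {j k : ℤ}
    {a b : R} (ha : a ∈ intPiece S.piece j) (hb : b ∈ intPiece S.piece k) :
    a * b ∈ intPiece S.piece (j + k) := by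
  have := S.graded
  cases j with
  | negSucc m =>
    have : a = 0 := ha
    simp [this]
  | ofNat m =>
    cases k with
    | negSucc l =>
      have : b = 0 := hb
      simp [this]
    | ofNat l =>
      have ha' : a ∈ S.piece m := ha
      have hb' : b ∈ S.piece l := hb
      exact (SetLike.mul_mem_graded ha' hb' : a * b ∈ S.piece (m + l))

/-! ### Supersymmetric algebras: universal property and induction -/

namespace SuperSym

variable {V : ℕ → Type v} [∀ n, AddCommGroup (V n)] [∀ n, Module ℂ (V n)]

/-- The universal property of the supersymmetric algebra. -/
theorem exists_lift {B : Type*} [Ring B] [Algebra ℂ B] (g : ∀ n, V n →ₗ[ℂ] B)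
    (hg : ∀ i j (v : V i) (w : V j), g i v * g j w = (-1 : ℂ) ^ (i * j) • (g j w * g i v)) :
    ∃ φ : SuperSym V →ₐ[ℂ] B, ∀ n (v : V n), φ (ι V n v) = g n v := by
  have key : ∀ n (v : V n), TensorAlgebra.lift ℂ (DirectSum.toModule ℂ ℕ B g)
      (TensorAlgebra.ι ℂ (DirectSum.lof ℂ ℕ V n v)) = g n v := fun n v => by
    rw [TensorAlgebra.lift_ι_apply, DirectSum.toModule_lof]
  refine ⟨RingQuot.liftAlgHom ℂ ⟨TensorAlgebra.lift ℂ (DirectSum.toModule ℂ ℕ B g), ?_⟩,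
    fun n v => ?_⟩
  · rintro _ _ ⟨i, j, v, w⟩
    rw [map_smul, map_mul, map_mul, key, key, hg]
  · change RingQuot.liftAlgHom ℂ _ (RingQuot.mkAlgHom ℂ _ _) = _
    rw [RingQuot.liftAlgHom_mkAlgHom_apply]
    exact key n v

/-- A subspace that contains `1` and is stable under left multiplication by generators is
everything. -/
theorem mem_of_mul_mem (N : Submodule ℂ (SuperSym V)) (h1 : 1 ∈ N)
    (hN : ∀ n (v : V n), ∀ x ∈ N, ι V n v * x ∈ N) (x : SuperSym V) : x ∈ N := by
  -- Stability of `N` under multiplication by `t` passes to products of such `t`; membership of `t`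
  -- in `N` would not.
  have step : ∀ (t : TensorAlgebra ℂ (DirectSum ℕ V)), ∀ y ∈ N,
      RingQuot.mkAlgHom ℂ (SuperSymRel V) t * y ∈ N := by
    intro t
    induction t using TensorAlgebra.induction with
    | algebraMap r =>
      intro y hy
      rw [AlgHom.commutes, ← Algebra.smul_def]
      exact N.smul_mem r hy
    | ι d =>
      induction d using DirectSum.induction_on with
      | zero => intro y hy; simp
      | of n v => exact fun y hy => hN n v y hy
      | add a b ha hb =>
        intro y hy
        rw [map_add, map_add, add_mul]
        exact N.add_mem (ha y hy) (hb y hy)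
    | mul a b ha hb =>
      intro y hy
      rw [map_mul, mul_assoc]
      exact ha _ (hb y hy)
    | add a b ha hb =>
      intro y hy
      rw [map_add, add_mul]
      exact N.add_mem (ha y hy) (hb y hy)
  obtain ⟨t, rfl⟩ := RingQuot.mkAlgHom_surjective ℂ (SuperSymRel V) x
  simpa using step t 1 h1

end SuperSym

/-! ### Derivations of free graded algebras -/

namespace DGAlg

variable {R : Type u} [Ring R] [Algebra ℂ R] (S : DGAlg R)

/-- `V` is a graded space of free generators of `R`. -/
structure IsFreeOn (V : ℕ → Submodule ℂ R) : Prop where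
  le_piece : ∀ n, V n ≤ S.piece n
  exists_equiv : ∃ e : SuperSym (fun n => V n) ≃ₐ[ℂ] R,
      ∀ (n : ℕ) (x : V n), e (SuperSym.ι (fun n => V n) n x) = x

section Free

variable {S} {V : ℕ → Submodule ℂ R}

theorem IsFreeOn.mem_of_mul_mem (hV : S.IsFreeOn V) (N : Submodule ℂ R) (h1 : 1 ∈ N)
    (hN : ∀ n, ∀ v ∈ V n, ∀ x ∈ N, v * x ∈ N) (x : R) : x ∈ N := by
  obtain ⟨e, he⟩ := hV.exists_equiv
  have := SuperSym.mem_of_mul_mem (N.comap e.toLinearMap) (by simpa using h1)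
    (fun n v y hy => by
      change e (_ * y) ∈ N
      rw [map_mul, he]
      exact hN n v v.2 _ hy) (e.symm x)
  change e (e.symm x) ∈ N at this
  rwa [e.apply_symm_apply] at this

/-- Induction for homogeneous elements of a free supercommutative algebra. -/
theorem IsFreeOn.piece_le (hV : S.IsFreeOn V) (M : ℕ → Submodule ℂ R) (h1 : 1 ∈ M 0)
    (hM : ∀ k j, ∀ v ∈ V k, ∀ x ∈ S.piece j, x ∈ M j → v * x ∈ M (k + j)) (j : ℕ) :
    S.piece j ≤ M j := by
  have := S.graded
  -- The elements all of whose homogeneous components satisfy `M`. A generator `v` of degree `k`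
  -- shifts components by `k`, so `N` is stable under multiplication by `v`.
  let N : Submodule ℂ R := ⨅ i, (M i).comap (GradedAlgebra.proj S.piece i)
  have memN : ∀ x, x ∈ N ↔ ∀ i, (DirectSum.decompose S.piece x i : R) ∈ M i := fun x => by
    simp [N, Submodule.mem_iInf]
  have hN : ∀ x, x ∈ N := hV.mem_of_mul_mem N
    ((memN 1).2 fun i => by
      by_cases hi : i = 0
      · subst hi
        rwa [DirectSum.decompose_of_mem_same S.piece SetLike.GradedOne.one_mem]
      · rw [DirectSum.decompose_of_mem_ne S.piece SetLike.GradedOne.one_mem (Ne.symm hi)]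
        exact zero_mem _)
    (fun k v hv x hx => (memN _).2 fun i => by
      by_cases hk : k ≤ i
      · rw [DirectSum.coe_decompose_mul_of_left_mem_of_le S.piece (hV.le_piece k hv) hk]
        have := hM k (i - k) v hv _ (SetLike.coe_mem _) ((memN x).1 hx (i - k))
        rwa [Nat.add_sub_cancel' hk] at this
      · rw [DirectSum.coe_decompose_mul_of_left_mem_of_not_le S.piece (hV.le_piece k hv) hk]
        exact zero_mem _)
  intro x hx
  have := (memN x).1 (hN x) j
  rwa [DirectSum.decompose_of_mem_same S.piece hx] at this

theorem mem_of_forall_piece (N : Submodule ℂ R) (h : ∀ j, S.piece j ≤ N) (x : R) : x ∈ N := by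
  classical
  have := S.graded
  rw [← DirectSum.sum_support_decompose S.piece x]
  exact N.sum_mem fun i _ => h i (SetLike.coe_mem _)

theorem gradedDer_one {n : ℤ} {δ : Module.End ℂ R} (hδ : δ ∈ S.Der n) : δ 1 = 0 := by
  have := S.graded
  have := hδ.2 0 1 SetLike.GradedOne.one_mem 1
  simpa using this

/-- A derivation is determined in degrees below `i` by its values on generators of degree below
`i`. -/
theorem IsFreeOn.der_apply_eq_zero (hV : S.IsFreeOn V) {n : ℤ} {δ : Module.End ℂ R}
    (hδ : δ ∈ S.Der n) (i : ℕ) (h : ∀ k < i, ∀ v ∈ V k, δ v = 0) {j : ℕ} (hj : j < i) {x : R}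
    (hx : x ∈ S.piece j) : δ x = 0 := by
  -- Nothing is required from degree `i` on; a product of degree below `i` has both factors of
  -- degree below `i`.
  have := hV.piece_le (fun j => if j < i then LinearMap.ker δ else ⊤)
    (by
      split_ifs
      · exact gradedDer_one hδ
      · trivial)
    (fun k j v hv x _ hx' => by
      by_cases hkj : k + j < i
      · rw [if_pos (by omega), LinearMap.mem_ker] at hx'
        rw [if_pos hkj, LinearMap.mem_ker, hδ.2 k v (hV.le_piece k hv), hx', h k (by omega) v hv]
        simp
      · rw [if_neg hkj]; trivial) j hx
  simpa [hj] using this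

theorem IsFreeOn.der_ext (hV : S.IsFreeOn V) {n : ℤ} {δ ε : Module.End ℂ R}
    (hδ : δ ∈ S.Der n) (hε : ε ∈ S.Der n) (h : ∀ k, ∀ v ∈ V k, δ v = ε v) : δ = ε := by
  refine LinearMap.ext fun x => ?_
  have := mem_of_forall_piece (S := S) (LinearMap.ker (δ - ε)) (fun j x hx =>
    hV.der_apply_eq_zero (sub_mem hδ hε) (j + 1)
      (fun k _ v hv => by simp [h k v hv]) (Nat.lt_succ_self j) hx) x
  simpa [sub_eq_zero] using this

/-- Every degree `n` map on free generators extends to a derivation of degree `n`. -/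
theorem IsFreeOn.exists_der (hV : S.IsFreeOn V) (n : ℤ) (f : ∀ i, V i →ₗ[ℂ] R)
    (hf : ∀ (i : ℕ) (v : V i), f i v ∈ intPiece S.piece (i + n)) :
    ∃ σ ∈ S.Der n, ∀ i (v : V i), σ v = f i v := by
  have := S.graded
  obtain ⟨e, he⟩ := hV.exists_equiv
  -- The twisted Leibniz rule for `σ` says that `x ↦ !![(-1)^(n|x|) x, σ x; 0, x]` is
  -- multiplicative, so extending a derivation becomes extending an algebra map.
  let g : ∀ i, V i →ₗ[ℂ] Matrix (Fin 2) (Fin 2) R := fun i =>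
    { toFun := fun v => !![(-1 : ℂ) ^ (n * i) • (v : R), f i v; 0, (v : R)]
      map_add' := fun v w => by
        ext a b; fin_cases a <;> fin_cases b <;> simp
      map_smul' := fun c v => by
        ext a b; fin_cases a <;> fin_cases b <;> simp [smul_comm c] }
  have hg : ∀ i (v : V i), g i v = !![(-1 : ℂ) ^ (n * i) • (v : R), f i v; 0, (v : R)] :=
    fun _ _ => rfl
  obtain ⟨φ', hφ'⟩ := SuperSym.exists_lift g (fun i j v w => by
    have h1 := S.supercomm i j v (hV.le_piece i v.2) w (hV.le_piece j w.2)
    have h2 := mul_comm_of_mem_intPiece S j _ (hf i v) (hV.le_piece j w.2)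
    have h3 := mul_comm_of_mem_intPiece S i _ (hf j w) (hV.le_piece i v.2)
    have hne : (-1 : ℂ) ≠ 0 := by norm_num
    have hij : (-1 : ℂ) ^ (i * j) = (-1 : ℂ) ^ ((i : ℤ) * j) := by norm_cast
    rw [add_mul, zpow_add₀ hne] at h2 h3
    have hs := negOne_zpow_mul_self ((i : ℤ) * j)
    have ht := negOne_zpow_mul_self (n * i)
    rw [hij] at h1
    rw [mul_comm (j : ℤ) i] at h3
    rw [hij]
    simp only [hg, Matrix.mul_fin_two, Matrix.smul_of, Matrix.smul_cons, Matrix.smul_empty]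
    generalize (-1 : ℂ) ^ ((i : ℤ) * j) = s at *
    generalize (-1 : ℂ) ^ (n * (i : ℤ)) = x at *
    generalize (-1 : ℂ) ^ (n * (j : ℤ)) = y at *
    have e1 : (x • (v : R)) * (y • (w : R)) + f i v * 0 =
        s • ((y • (w : R)) * (x • (v : R)) + f j w * 0) := by
      simp only [smul_mul_assoc, mul_smul_comm, h1, mul_zero, add_zero, smul_smul]
      module
    -- Moving `f i v`, of degree `i + n`, past `w` costs `(-1)^(n j)` beyond the usual sign, which
    -- is the diagonal twist of `w`; likewise with the roles exchanged.
    have e2 : (x • (v : R)) * f j w + f i v * (w : R) =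
        s • ((y • (w : R)) * f i v + f j w * (v : R)) := by
      simp only [smul_mul_assoc, h2, h3, smul_add, smul_smul]
      match_scalars
      · linear_combination (-x) * hs
      · ring
    rw [e1, e2]
    simp [h1])
  let φ : R →ₐ[ℂ] Matrix (Fin 2) (Fin 2) R := φ'.comp e.symm.toAlgHom
  have hφ : ∀ i (v : V i), φ v = !![(-1 : ℂ) ^ (n * i) • (v : R), f i v; 0, (v : R)] := by
    intro i v
    change φ' (e.symm (v : R)) = _
    rw [e.symm_apply_eq.2 (he i v).symm, hφ', hg]
  let entry : Fin 2 → Fin 2 → Module.End ℂ R := fun a b =>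
    Matrix.entryLinearMap ℂ R a b ∘ₗ φ.toLinearMap
  have hentry : ∀ a b x, entry a b x = φ x a b := fun _ _ _ => rfl
  -- The expected matrix shape in degree `j`, proved for all homogeneous elements by induction on
  -- products of generators.
  let M : ℕ → Submodule ℂ R := fun j =>
    LinearMap.ker (entry 0 0 - (-1 : ℂ) ^ (n * j) • LinearMap.id) ⊓ LinearMap.ker (entry 1 0) ⊓
      LinearMap.ker (entry 1 1 - LinearMap.id) ⊓ (intPiece S.piece (j + n)).comap (entry 0 1)
  have memM : ∀ j x, x ∈ M j ↔ φ x 0 0 = (-1 : ℂ) ^ (n * j) • x ∧ φ x 1 0 = 0 ∧ φ x 1 1 = x ∧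
      φ x 0 1 ∈ intPiece S.piece (j + n) := fun j x => by
    simp [M, hentry, sub_eq_zero, and_assoc]
  have hM : ∀ j, S.piece j ≤ M j := hV.piece_le M
    ((memM _ _).2 (by simp))
    (fun k j v hv x hx hxM => by
      obtain ⟨h00, h10, h11, h01⟩ := (memM _ _).1 hxM
      have hv' := hφ k ⟨v, hv⟩
      simp only at hv'
      have hvk : v ∈ intPiece S.piece (k : ℤ) := hV.le_piece k hv
      have hxj : x ∈ intPiece S.piece (j : ℤ) := hx
      have hne : (-1 : ℂ) ≠ 0 := by norm_num
      rw [memM]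
      simp only [map_mul, hv', Matrix.mul_apply, Fin.sum_univ_two, h00, h10, h11]
      refine ⟨?_, by simp, by simp, ?_⟩
      · simp [smul_smul, mul_add, zpow_add₀ hne, mul_comm]
      · simp only [Matrix.of_apply, Matrix.cons_val', Matrix.cons_val_zero, Matrix.cons_val_one,
          Matrix.cons_val_fin_one, smul_mul_assoc]
        refine add_mem (Submodule.smul_mem _ _ ?_) ?_
        · have := mul_mem_intPiece S hvk h01
          rwa [← add_assoc] at this
        · have := mul_mem_intPiece S (hf k ⟨v, hv⟩) hxj
          rwa [add_right_comm] at this)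
  have h11 : ∀ x, φ x 1 1 = x := fun x => by
    have := mem_of_forall_piece (S := S) (LinearMap.ker (entry 1 1 - LinearMap.id))
      (fun j x hx => by simp [hentry, ((memM j x).1 (hM j hx)).2.2.1]) x
    simpa [hentry, sub_eq_zero] using this
  refine ⟨entry 0 1, ⟨fun i a ha => ((memM i a).1 (hM i ha)).2.2.2, fun i a ha b => ?_⟩,
    fun i v => ?_⟩
  · have h00 := ((memM i a).1 (hM i ha)).1
    simp only [hentry, map_mul, Matrix.mul_apply, Fin.sum_univ_two, h00, h11, smul_mul_assoc]
    exact add_comm _ _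
  · rw [hentry, hφ]; rfl

end Free

/-! ### Homogeneity of the differential -/

theorem D_apply_eq_zero {x : R} (hx : x ∈ S.piece 0) : S.D x = 0 := S.D_mem.1 0 x hx

theorem D_mem_piece {j : ℕ} {x : R} (hx : x ∈ S.piece (j + 1)) : S.D x ∈ S.piece j := by
  have h := S.D_mem.1 (j + 1) x hx
  rwa [show ((j + 1 : ℕ) : ℤ) + -1 = (j : ℤ) by push_cast; ring] at h

/-- `D` intertwines the projections to degrees `m + 1` and `m`, so the component of `r` in degree `m
+ 1` is already a preimage. -/
theorem exists_D_eq_of_mem_range {m : ℕ} {a r : R} (ha : a ∈ S.piece m) (hr : S.D r = a) :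
    ∃ b ∈ S.piece (m + 1), S.D b = a := by
  have := S.graded
  refine ⟨DirectSum.decompose S.piece r (m + 1), SetLike.coe_mem _, ?_⟩
  rw [← DirectSum.decompose_of_mem_same S.piece ha, ← hr]
  have key := mem_of_forall_piece (S := S) (LinearMap.ker
    (S.D ∘ₗ GradedAlgebra.proj S.piece (m + 1) - GradedAlgebra.proj S.piece m ∘ₗ S.D))
    (fun j x hx => by
      rw [LinearMap.mem_ker, LinearMap.sub_apply, LinearMap.comp_apply, LinearMap.comp_apply,
        GradedAlgebra.proj_apply, GradedAlgebra.proj_apply, sub_eq_zero]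
      cases j with
      | zero =>
        rw [S.D_apply_eq_zero hx, DirectSum.decompose_of_mem_ne S.piece hx (by omega)]
        simp
      | succ j =>
        by_cases hj : j = m
        · subst hj
          rw [DirectSum.decompose_of_mem_same S.piece hx,
            DirectSum.decompose_of_mem_same S.piece (S.D_mem_piece hx)]
        · rw [DirectSum.decompose_of_mem_ne S.piece hx (by omega),
            DirectSum.decompose_of_mem_ne S.piece (S.D_mem_piece hx) hj, map_zero]) r
  simpa [sub_eq_zero] using key

/-! ### Acyclicity of derivations with values in the kernel -/

section Resolution

variable {S} {A : Type v} [CommRing A] [Algebra ℂ A] {π : R →ₐ[ℂ] A}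

/-- A linear map vanishing in positive degrees only sees the component of degree `0`. -/
theorem exists_degree_zero_component (S : DGAlg R) (r : R) : ∃ r₀ ∈ S.piece 0,
    ∀ L : R →ₗ[ℂ] A, (∀ j, 0 < j → ∀ x ∈ S.piece j, L x = 0) → L r₀ = L r := by
  have := S.graded
  refine ⟨DirectSum.decompose S.piece r 0, SetLike.coe_mem _, fun L hL => ?_⟩
  have key := mem_of_forall_piece (S := S) (LinearMap.ker
    (L ∘ₗ GradedAlgebra.proj S.piece 0 - L)) (fun j x hx => by
      rw [LinearMap.mem_ker, LinearMap.sub_apply, LinearMap.comp_apply, GradedAlgebra.proj_apply]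
      rcases Nat.eq_zero_or_pos j with rfl | hj
      · rw [DirectSum.decompose_of_mem_same S.piece hx, sub_self]
      · rw [DirectSum.decompose_of_mem_ne S.piece hx hj.ne', hL j hj x hx, map_zero, sub_zero]) r
  simpa [sub_eq_zero] using key

theorem IsAugmentation.map_intPiece (h : S.IsAugmentation π) {k : ℤ} (hk : 0 < k) {a : R}
    (ha : a ∈ intPiece S.piece k) : π a = 0 := by
  cases k with
  | ofNat m => exact h.map_pos m (by simpa using hk) a ha
  | negSucc m => exact absurd hk (by simp)

theorem IsResolution.exists_degree_zero (h : S.IsResolution π) (a : A) :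
    ∃ r ∈ S.piece 0, π r = a := by
  obtain ⟨h, -, hs⟩ := h
  obtain ⟨x, hx⟩ := hs a
  induction x using Submodule.Quotient.induction_on with | _ x
  obtain ⟨r, hr, hr'⟩ := S.exists_degree_zero_component (A := A) x.1
  exact ⟨r, hr, (hr' π.toLinearMap h.map_pos).trans hx⟩

/-- Acyclicity of `ker π`. For `m ≥ 0`, injectivity on homology gives a primitive of degree `m + 1 >
0`, which `π` kills automatically; for `m < 0` the element is zero, and so is the chosen primitive.
-/
theorem IsResolution.exists_D_eq (h : S.IsResolution π) {m : ℤ} {a : R}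
    (ha : a ∈ intPiece S.piece m) (hD : S.D a = 0) (hπ : π a = 0) :
    ∃ b ∈ intPiece S.piece (m + 1), S.D b = a ∧ π b = 0 := by
  obtain ⟨h, hi, -⟩ := h
  cases m with
  | negSucc m =>
    have : a = 0 := ha
    exact ⟨0, zero_mem _, by simp [this], by simp⟩
  | ofNat m =>
    have h0 : (Submodule.Quotient.mk ⟨a, hD⟩ : S.Homology) = 0 := hi (by
      rw [map_zero]; exact hπ)
    obtain ⟨r, hr⟩ := (Submodule.Quotient.mk_eq_zero _).1 h0
    obtain ⟨b, hb, hb'⟩ := S.exists_D_eq_of_mem_range ha hr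
    exact ⟨b, hb, hb', h.map_pos _ (Nat.succ_pos m) b hb⟩

variable {V : ℕ → Submodule ℂ R}

theorem IsFreeOn.map_der_eq_zero (hV : S.IsFreeOn V) {n : ℤ} {δ : Module.End ℂ R}
    (hδ : δ ∈ S.Der n) (h : ∀ k, ∀ v ∈ V k, π (δ v) = 0) (x : R) : π (δ x) = 0 :=
  hV.mem_of_mul_mem (LinearMap.ker (π.toLinearMap ∘ₗ δ))
    (by simp [gradedDer_one hδ])
    (fun k v hv x hx => by
      have hx' : π (δ x) = 0 := hx
      change π (δ (v * x)) = 0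
      rw [hδ.2 k v (hV.le_piece k hv), map_add, map_mul, map_smul, map_mul, h k v hv, hx']
      simp) x

/-- As `D` lowers degree, control of `δ` strictly below `i` reaches `D v` even for `v` of degree
`i`. This drives the induction over generators. -/
theorem IsFreeOn.der_D_eq_zero (hV : S.IsFreeOn V) {n : ℤ} {δ : Module.End ℂ R}
    (hδ : δ ∈ S.Der n) {i : ℕ} (h : ∀ k < i, ∀ v ∈ V k, δ v = 0) {k : ℕ} (hk : k ≤ i) {v : R}
    (hv : v ∈ S.piece k) : δ (S.D v) = 0 := by
  cases k with
  | zero => rw [S.D_apply_eq_zero hv, map_zero]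
  | succ k => exact hV.der_apply_eq_zero hδ i h hk (S.D_mem_piece hv)

theorem adD_apply_apply (n : ℤ) (f : Module.End ℂ R) (x : R) :
    S.adD n f x = S.D (f x) - (-1 : ℂ) ^ n • f (S.D x) := by
  rw [adD_apply]; rfl

/-- The error `τ = ρ - [D, σ]` is a cycle with values in `ker π` that vanishes below degree `i`.
Hence `D (τ v) = ± τ (D v) = 0` on `V i`, so `τ v` has a primitive in `ker π`, and adding a
derivation with these values on `V i` removes the error there. -/
theorem exists_der_step (hV : S.IsFreeOn V) (hπ : S.IsResolution π) {n : ℤ}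
    {ρ : Module.End ℂ R} (hρ : ρ ∈ S.derCycles n) (hρπ : ∀ x, π (ρ x) = 0) (i : ℕ)
    {σ : Module.End ℂ R} (hσ : σ ∈ S.Der (n + 1)) (hσπ : ∀ x, π (σ x) = 0)
    (h : ∀ k < i, ∀ v ∈ V k, S.adD (n + 1) σ v = ρ v) :
    ∃ σ' ∈ S.Der (n + 1), (∀ x, π (σ' x) = 0) ∧ (∀ k < i, ∀ v ∈ V k, σ' v = σ v) ∧
      ∀ k < i + 1, ∀ v ∈ V k, S.adD (n + 1) σ' v = ρ v := by
  obtain ⟨haug, -⟩ := id hπ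
  have hτ : ρ - S.adD (n + 1) σ ∈ S.Der n := sub_mem hρ.1 (S.adD_mem rfl hσ)
  have hτc : S.adD n (ρ - S.adD (n + 1) σ) = 0 := by
    have h1 : S.adD n ρ = 0 := hρ.2
    rw [map_sub, h1, S.adD_adD rfl, sub_zero]
  have hτπ : ∀ x, π ((ρ - S.adD (n + 1) σ) x) = 0 := fun x => by
    rw [LinearMap.sub_apply, map_sub, hρπ, adD_apply_apply, map_sub, map_smul, haug.map_D, hσπ]
    simp
  have hτ0 : ∀ k < i, ∀ v ∈ V k, (ρ - S.adD (n + 1) σ) v = 0 := fun k hk v hv => by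
    rw [LinearMap.sub_apply, h k hk v hv, sub_self]
  have hτv : ∀ x, (ρ - S.adD (n + 1) σ) x = ρ x - S.adD (n + 1) σ x := fun _ => rfl
  generalize ρ - S.adD (n + 1) σ = τ at *
  obtain ⟨s, hs⟩ := exists_linearMap_lift S.D
    (intPiece S.piece (i + (n + 1)) ⊓ LinearMap.ker π.toLinearMap) (τ ∘ₗ (V i).subtype)
    (fun v => by
      have hv := hV.le_piece i v.2
      have hDτ : S.D (τ v) = 0 := by
        have := LinearMap.congr_fun hτc (v : R)
        rw [adD_apply_apply, hV.der_D_eq_zero hτ hτ0 le_rfl hv] at this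
        simpa using this
      obtain ⟨b, hb, hb', hb''⟩ := hπ.exists_D_eq (hτ.1 i v hv) hDτ (hτπ v)
      rw [add_assoc] at hb
      exact ⟨b, ⟨hb, hb''⟩, hb'⟩)
  -- The correction is zero on all generators outside `V i`, so the earlier stages are undisturbed.
  obtain ⟨δ, hδ, hδv⟩ := hV.exists_der (n + 1)
    (Pi.single (M := fun k => V k →ₗ[ℂ] R) i s) (fun k v => by
      by_cases hk : k = i
      · subst hk
        rw [Pi.single_eq_same]; exact (hs v).1.1
      · rw [Pi.single_eq_of_ne hk]; exact zero_mem _)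
  have hδ0 : ∀ k, k ≠ i → ∀ v ∈ V k, δ v = 0 := fun k hk v hv => by
    rw [hδv k ⟨v, hv⟩, Pi.single_eq_of_ne hk]; rfl
  have hδi : ∀ v : V i, δ v = s v := fun v => by
    rw [hδv i v, Pi.single_eq_same]
  have hδπ : ∀ x, π (δ x) = 0 := hV.map_der_eq_zero hδ fun k v hv => by
    by_cases hk : k = i
    · subst hk
      rw [hδi ⟨v, hv⟩]; exact (hs _).1.2
    · rw [hδ0 k hk v hv, map_zero]
  refine ⟨σ + δ, add_mem hσ hδ, fun x => ?_, fun k hk v hv => ?_, fun k hk v hv => ?_⟩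
  · rw [LinearMap.add_apply, map_add, hσπ, hδπ, add_zero]
  · rw [LinearMap.add_apply, hδ0 k hk.ne v hv, add_zero]
  · rw [map_add, LinearMap.add_apply, adD_apply_apply _ δ, hV.der_D_eq_zero hδ
      (fun k hk => hδ0 k hk.ne) (Nat.le_of_lt_succ hk) (hV.le_piece k hv), smul_zero, sub_zero]
    by_cases hki : k = i
    · subst hki
      rw [hδi ⟨v, hv⟩, (hs _).2]
      change _ + τ v = _
      rw [hτv, add_sub_cancel]
    · rw [hδ0 k hki v hv, map_zero, add_zero, h k (by omega) v hv]

/-- The derivations with image in the kernel of a resolution form an acyclic complex. -/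
theorem exists_adD_eq (hV : S.IsFreeOn V) (hπ : S.IsResolution π) {n : ℤ}
    {ρ : Module.End ℂ R} (hρ : ρ ∈ S.derCycles n) (hρπ : ∀ x, π (ρ x) = 0) :
    ∃ σ ∈ S.Der (n + 1), (∀ x, π (σ x) = 0) ∧ S.adD (n + 1) σ = ρ := by
  let P : ℕ → Module.End ℂ R → Prop := fun i σ => σ ∈ S.Der (n + 1) ∧ (∀ x, π (σ x) = 0) ∧
    ∀ k < i, ∀ v ∈ V k, S.adD (n + 1) σ v = ρ v
  have step : ∀ i (σ : {σ // P i σ}), ∃ σ' : {σ // P (i + 1) σ},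
      ∀ k < i, ∀ v ∈ V k, σ'.1 v = σ.1 v := fun i σ => by
    obtain ⟨σ', h1, h2, h3, h4⟩ := exists_der_step hV hπ hρ hρπ i σ.2.1 σ.2.2.1 σ.2.2.2
    exact ⟨⟨σ', h1, h2, h4⟩, h3⟩
  choose next hnext using step
  -- Stage `0` may be the zero derivation, since `P 0` imposes no equation on generators.
  let seq : ∀ i, {σ // P i σ} := fun i =>
    Nat.rec (motive := fun i => {σ // P i σ}) ⟨0, zero_mem _, by simp, by simp⟩ next i
  have hseq : ∀ j k, k < j → ∀ v ∈ V k, (seq j).1 v = (seq (k + 1)).1 v := fun j k hkj => by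
    induction j, hkj using Nat.le_induction with
    | base => exact fun _ _ => rfl
    | succ j hj ih => exact fun v hv => (hnext j (seq j) k hj v hv).trans (ih v hv)
  -- The limit of the stages: values on `V k` are final from stage `k + 1` on, as stage `i` settles
  -- the degrees below `i`.
  obtain ⟨σ, hσ, hσv⟩ := hV.exists_der (n + 1) (fun k => (seq (k + 1)).1 ∘ₗ (V k).subtype)
    (fun k v => (seq (k + 1)).2.1.1 k v (hV.le_piece k v.2))
  have hσv' : ∀ k, ∀ v ∈ V k, σ v = (seq (k + 1)).1 v := fun k v hv => hσv k ⟨v, hv⟩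
  refine ⟨σ, hσ, hV.map_der_eq_zero hσ fun k v hv => ?_,
    hV.der_ext (S.adD_mem rfl hσ) hρ.1 fun k v hv => ?_⟩
  · rw [hσv' k v hv]; exact (seq (k + 1)).2.2.1 v
  · have hD : σ (S.D v) = (seq (k + 1)).1 (S.D v) := by
      rw [← sub_eq_zero, ← LinearMap.sub_apply]
      exact hV.der_D_eq_zero (sub_mem hσ (seq (k + 1)).2.1) (i := k + 1)
        (fun l hl w hw => by
          rw [LinearMap.sub_apply, hσv' l w hw, hseq (k + 1) l hl w hw, sub_self])
        (Nat.le_succ k) (hV.le_piece k hv)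
    rw [← (seq (k + 1)).2.2.2 k (Nat.lt_succ_self k) v hv, adD_apply_apply, adD_apply_apply,
      hσv' k v hv, hD]

/-! ### Cycles of degree zero and derivations of `A` -/

theorem IsAugmentation.map_derBoundaries (h : S.IsAugmentation π) {τ : Module.End ℂ R}
    (hτ : τ ∈ S.derBoundaries 0) (x : R) : π (τ x) = 0 := by
  obtain ⟨σ, hσ, rfl⟩ := hτ
  -- `σ` has degree `1`, so its values lie in positive degrees.
  have hσπ : ∀ x, π (σ x) = 0 := fun x =>
    mem_of_forall_piece (S := S) (LinearMap.ker (π.toLinearMap ∘ₗ σ))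
      (fun j x hx => h.map_intPiece (by omega) (hσ.1 j x hx)) x
  rw [adD_apply_apply, map_sub, map_smul, h.map_D, hσπ, smul_zero, sub_zero]

theorem D_comm_of_mem_derCycles {τ : Module.End ℂ R} (hτ : τ ∈ S.derCycles 0) (x : R) :
    S.D (τ x) = τ (S.D x) := by
  have := LinearMap.congr_fun (show S.adD 0 τ = 0 from hτ.2) x
  rw [adD_apply_apply] at this
  simpa [sub_eq_zero] using this

/-- Only the degree `0` component of `r` matters. It is a cycle killed by `π`, hence some `D b`, and
`τ (D b) = D (τ b)` is killed by `π`. -/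
theorem IsResolution.map_derCycle_eq_zero (hπ : S.IsResolution π) {τ : Module.End ℂ R}
    (hτ : τ ∈ S.derCycles 0) {r : R} (hr : π r = 0) : π (τ r) = 0 := by
  obtain ⟨haug, -⟩ := id hπ
  obtain ⟨r₀, hr₀, hL⟩ := S.exists_degree_zero_component (A := A) r
  have h1 : π r₀ = π r := hL π.toLinearMap haug.map_pos
  have h2 : π (τ r₀) = π (τ r) := hL (π.toLinearMap ∘ₗ τ) fun j hj x hx =>
    haug.map_intPiece (by omega) (hτ.1.1 j x hx)
  obtain ⟨b, -, hb, -⟩ := hπ.exists_D_eq (m := 0) hr₀ (S.D_apply_eq_zero hr₀) (h1.trans hr)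
  rw [← h2, ← hb, ← D_comm_of_mem_derCycles hτ, haug.map_D]

theorem der_zero_leibniz {τ : Module.End ℂ R} (hτ : τ ∈ S.Der 0) (a b : R) :
    τ (a * b) = τ a * b + a * τ b := by
  have := mem_of_forall_piece (S := S) (LinearMap.ker (τ ∘ₗ (LinearMap.mul ℂ R).flip b
    - (LinearMap.mul ℂ R).flip b ∘ₗ τ - (LinearMap.mul ℂ R).flip (τ b)))
    (fun j x hx => by simp [hτ.2 j x hx b]) a
  simp only [LinearMap.mem_ker, LinearMap.sub_apply, LinearMap.comp_apply, LinearMap.flip_apply,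
    LinearMap.mul_apply'] at this
  rw [← sub_eq_zero, ← this]
  abel

theorem IsResolution.surjective (hπ : S.IsResolution π) : Function.Surjective π := fun a =>
  let ⟨r, _, hr⟩ := hπ.exists_degree_zero a
  ⟨r, hr⟩

/-- Since `τ` preserves `ker π`, the class `π (τ r)` depends only on `π r`; any set-theoretic
section of `π` then defines the same map, and linearity and the Leibniz rule are inherited from `τ`.
-/
theorem IsResolution.exists_derivation (hπ : S.IsResolution π) (τ : S.derCycles 0) :
    ∃ d : Derivation ℂ A A, ∀ r, d (π r) = π (τ.1 r) := by
  have hwd : ∀ {r r'}, π r = π r' → π (τ.1 r) = π (τ.1 r') := fun {r r'} h => by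
    rw [← sub_eq_zero, ← map_sub, ← map_sub]
    exact hπ.map_derCycle_eq_zero τ.2 (by rw [map_sub, h, sub_self])
  obtain ⟨c, hc⟩ := hπ.surjective.hasRightInverse
  refine ⟨Derivation.mk'
    { toFun := fun a => π (τ.1 (c a))
      map_add' := fun a b => by
        rw [← map_add, ← map_add]; exact hwd (by simp only [map_add, hc _])
      map_smul' := fun z a => by
        rw [RingHom.id_apply, ← map_smul, ← map_smul]
        exact hwd (by simp only [map_smul, hc _]) } fun a b => ?_, fun r => hwd (hc _)⟩
  change π (τ.1 (c (a * b))) = a • π (τ.1 (c b)) + b • π (τ.1 (c a))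
  rw [hwd (show π (c (a * b)) = π (c a * c b) by simp only [map_mul, hc _]),
    der_zero_leibniz τ.2.1, map_add, map_mul, map_mul, hc, hc, smul_eq_mul, smul_eq_mul, mul_comm b,
    add_comm]

/-- The derivation of `A` induced by a cycle of degree `0` in the derivations of a resolution. -/
noncomputable def IsResolution.toDerivation (hπ : S.IsResolution π) :
    S.derCycles 0 →ₗ[ℂ] Derivation ℂ A A where
  toFun τ := (hπ.exists_derivation τ).choose
  map_add' τ τ' := by
    ext a
    obtain ⟨r, rfl⟩ := hπ.surjective a
    rw [(hπ.exists_derivation (τ + τ')).choose_spec]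
    simp [(hπ.exists_derivation _).choose_spec]
  map_smul' z τ := by
    ext a
    obtain ⟨r, rfl⟩ := hπ.surjective a
    rw [(hπ.exists_derivation (z • τ)).choose_spec]
    simp [(hπ.exists_derivation _).choose_spec]

theorem IsResolution.toDerivation_apply (hπ : S.IsResolution π) (τ : S.derCycles 0) (r : R) :
    hπ.toDerivation τ (π r) = π (τ.1 r) :=
  (hπ.exists_derivation τ).choose_spec r

theorem IsResolution.ker_toDerivation (hV : S.IsFreeOn V) (hπ : S.IsResolution π) :
    LinearMap.ker hπ.toDerivation = (S.derBoundaries 0).submoduleOf (S.derCycles 0) := by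
  obtain ⟨haug, -⟩ := id hπ
  ext τ
  rw [LinearMap.mem_ker]
  refine ⟨fun h => ?_, fun h => ?_⟩
  · obtain ⟨σ, hσ, -, hσρ⟩ := exists_adD_eq hV hπ τ.2 fun x => by
      rw [← hπ.toDerivation_apply, h]; rfl
    exact ⟨σ, hσ, hσρ⟩
  · ext a
    obtain ⟨r, rfl⟩ := hπ.surjective a
    rw [hπ.toDerivation_apply]
    exact haug.map_derBoundaries h r

theorem IsResolution.toDerivation_surjective (hV : S.IsFreeOn V) (hπ : S.IsResolution π) :
    Function.Surjective hπ.toDerivation := by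
  intro d
  obtain ⟨haug, -⟩ := id hπ
  -- Only the generators of degree `0` need lifting: `π` kills the others, so `τ` may vanish on
  -- them.
  obtain ⟨s, hs⟩ := exists_linearMap_lift π.toLinearMap (S.piece 0)
    (d.toLinearMap ∘ₗ π.toLinearMap ∘ₗ (V 0).subtype)
    (fun v => hπ.exists_degree_zero (d (π v)))
  obtain ⟨τ, hτ, hτv⟩ := hV.exists_der 0 (Pi.single (M := fun k => V k →ₗ[ℂ] R) 0 s)
    (fun k v => by
      by_cases hk : k = 0
      · subst hk
        rw [Pi.single_eq_same]; exact (hs v).1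
      · rw [Pi.single_eq_of_ne hk]; exact zero_mem _)
  have hτd : ∀ x, π (τ x) = d (π x) := fun x => by
    rw [← sub_eq_zero]
    refine hV.mem_of_mul_mem (LinearMap.ker (π.toLinearMap ∘ₗ τ - d.toLinearMap ∘ₗ π.toLinearMap))
      (by simp [gradedDer_one hτ]) (fun k v hv x hx => ?_) x
    have hx' : π (τ x) - d (π x) = 0 := hx
    have hv' : π (τ v) = d (π v) := by
      by_cases hk : k = 0
      · subst hk
        rw [hτv 0 ⟨v, hv⟩, Pi.single_eq_same]
        exact (hs _).2
      · rw [hτv k ⟨v, hv⟩, Pi.single_eq_of_ne hk,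
          haug.map_pos k (Nat.pos_of_ne_zero hk) v (hV.le_piece k hv)]
        simp
    change π (τ (v * x)) - d (π (v * x)) = 0
    rw [der_zero_leibniz hτ, map_add, map_mul, map_mul, map_mul, Derivation.leibniz, hv',
      sub_eq_zero.1 hx', smul_eq_mul, smul_eq_mul]
    ring
  have hρ : S.adD 0 τ ∈ S.derCycles (-1) :=
    S.derBoundaries_le_derCycles (-1) ⟨τ, hτ, rfl⟩
  -- `τ` need not commute with `D`, but `[D, τ]` has values in `ker π`. Since `σ` does too,
  -- subtracting it yields a cycle inducing the same `d`.
  obtain ⟨σ, hσ, hσπ, hσρ⟩ := exists_adD_eq hV hπ hρ fun x => by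
    rw [adD_apply_apply, map_sub, map_smul, hτd, haug.map_D, haug.map_D]
    simp
  refine ⟨⟨τ - σ, sub_mem hτ hσ, ?_⟩, ?_⟩
  · change S.adD 0 (τ - σ) = 0
    rw [map_sub, sub_eq_zero]
    exact hσρ.symm
  · ext a
    obtain ⟨r, rfl⟩ := hπ.surjective a
    rw [hπ.toDerivation_apply]
    simp [hτd, hσπ]

end Resolution

end DGAlg

/-! ### The main theorem -/

theorem lemma4p5p1 {A : Type v} [CommRing A] [Algebra ℂ A] [Algebra.FiniteType ℂ A]
    {R : Type u} [Ring R] [Algebra ℂ R] (S : DGAlg R) (hS : S.IsQuasiFree)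
    (π : R →ₐ[ℂ] A) (hπ : S.IsResolution π) :
    (∀ n : ℤ, 0 < n → Subsingleton (S.DerHomology n)) ∧
    ∃ Φ : S.DerHomology 0 ≃ₗ⁅ℂ⁆ Derivation ℂ A A,
      ∀ (τ : S.derCycles 0) (r : R), Φ (Submodule.Quotient.mk τ) (π r) = π (τ.1 r) := by
  obtain ⟨V, hV₁, -, hV₂⟩ := hS
  have hV : S.IsFreeOn V := ⟨hV₁, hV₂⟩
  obtain ⟨haug, -⟩ := id hπ
  refine ⟨fun n hn => ?_, ?_⟩
  · rw [Submodule.Quotient.subsingleton_iff, eq_top_iff]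
    intro τ _
    -- For `n > 0` the values of `τ` lie in positive degrees, so acyclicity applies to every cycle.
    obtain ⟨σ, hσ, -, h⟩ := DGAlg.exists_adD_eq hV hπ τ.2 fun x =>
      DGAlg.mem_of_forall_piece (S := S) (LinearMap.ker (π.toLinearMap ∘ₗ τ.1))
        (fun j x hx => haug.map_intPiece (by omega) (τ.2.1.1 j x hx)) x
    exact ⟨σ, hσ, h⟩
  · let e : S.DerHomology 0 ≃ₗ[ℂ] Derivation ℂ A A :=
      (Submodule.quotEquivOfEq _ _ (hπ.ker_toDerivation hV).symm).trans
        (hπ.toDerivation.quotKerEquivOfSurjective (hπ.toDerivation_surjective hV))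
    have he : ∀ (τ : S.derCycles 0) (r : R), e (Submodule.Quotient.mk τ) (π r) = π (τ.1 r) :=
      hπ.toDerivation_apply
    refine ⟨{ e with map_lie' := ?_ }, he⟩
    intro x y
    induction x using Submodule.Quotient.induction_on with | _ f
    induction y using Submodule.Quotient.induction_on with | _ g
    change e (S.homologyBracket _ _ _) = ⁅e _, e _⁆
    rw [DGAlg.homologyBracket_mk]
    ext a
    obtain ⟨r, rfl⟩ := hπ.surjective a
    rw [he, Derivation.commutator_apply, he, he, he, he, DGAlg.cycleBracket_zero_coe]
    simp
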